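/- Let $A$ be a finite lattice algebra, i.e. a finite lattice $(A,\wedge,\vee)$ possibly equipped with additional finitary operations, and let $\tau$ be a finite vocabulary of relation symbols, each $R\in\tau$ having an arity $\tau(R)\ge 1$. The formulas of the $A$-valued predicate logic $\mathcal L^A(\tau)$ are built from the atomic formulas $R(x_{i_1},\dots,x_{i_{\tau(R)}})$, $R\in\tau$ (there is no identity symbol), by connectives corresponding to all operations of $A$ (including $\wedge,\vee$) and by the quantifiers $\forall,\exists$; a sentence is a formula without free variables. An $A$-valued $\tau$-structure $\mathfrak M$ with domain $[n]=\{1,\dots,n\}$, $n\ge 1$, consists of a map $R^{\mathfrak M}:[n]^{\tau(R)}\to A$ for each $R\in\tau$. The truth value $\|\varphi\|^{\mathfrak M}\in A$ of a sentence $\varphi$ is defined recursively, by interpreting atomic formulas according to $\mathfrak M$, connectives by the operations of $A$, and $\forall$, $\exists$ by infima and suprema in $A$ over the domain. For each $R\in\tau$ fix a probability distribution $p_R$ on $A$ with $p_R(a)>0$ for all $a\in A$. Let $$\Pr\nolimits_n(\mathfrak M)=\prod_{R\in\tau}\ \prod_{(i_1,\dots,i_{\tau(R)})\in[n]^{\tau(R)}}p_R\bigl(R^{\mathfrak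 M}(i_1,\dots,i_{\tau(R)})\bigr),\qquad \mu_n(\varphi=a)=\sum_{\mathfrak M:\ \|\varphi\|^{\mathfrak M}=a}\Pr\nolimits_n(\mathfrak M),$$ where $\mathfrak M$ ranges over the $A$-valued $\tau$-structures with domain $[n]$. Then for every sentence $\varphi\in\mathcal L^A(\tau)$ and every $a\in A$, $\lim_{n\to\infty}\mu_n(\varphi=a)=1$ or $\lim_{n\to\infty}\mu_n(\varphi=a)=0$. Equivalently, for every sentence $\varphi\in\mathcal L^A(\tau)$ there is a unique $a\in A$ such that $\lim_{n\to\infty}\mu_n(\varphi=a)=1$. -/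

import Mathlib

open Filter Topology

namespace ManyValued

universe u v w x

/-- A family of symbols with finite arities. It serves both as a relational vocabulary
(predicate symbols) and as the list of the connectives that a lattice algebra may have besides
meet and join (operation symbols; arity `0` then gives truth constants). -/
structure Vocabulary where
  /-- the symbols -/
  Symb : Type u
  /-- the arity of each symbol -/
  arity : Symb → ℕ

/-- The additional operations of a lattice algebra with carrier `A`: an arbitrary interpretation
of the operation symbols in `σ`. Together with `[Lattice A]` this is a lattice algebra. -/
abbrev Operations (σ : Vocabulary.{u}) (A : Type v) : Type (max u v) :=
  (c : σ.Symb) → (Fin (σ.arity c) → A) → A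

/-- Formulas `φ(x₀, …, x_{k-1})` of the first-order predicate logic over the relational
vocabulary `τ` with connectives `∧`, `∨` and those of `σ`, having their free variables among
`x₀, …, x_{k-1}`. The quantifiers bind the variable with the last index. There is no identity
symbol. -/
inductive Formula (σ : Vocabulary.{u}) (τ : Vocabulary.{v}) : ℕ → Type (max u v)
  | rel {k : ℕ} (R : τ.Symb) (xs : Fin (τ.arity R) → Fin k) : Formula σ τ k
  | and {k : ℕ} (φ ψ : Formula σ τ k) : Formula σ τ k
  | or {k : ℕ} (φ ψ : Formula σ τ k) : Formula σ τ k
  | conn {k : ℕ} (c : σ.Symb) (φs : Fin (σ.arity c) → Formula σ τ k) : Formula σ τ k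
  | all {k : ℕ} (φ : Formula σ τ (k + 1)) : Formula σ τ k
  | ex {k : ℕ} (φ : Formula σ τ (k + 1)) : Formula σ τ k

/-- Sentences: formulas without free variables. -/
abbrev Sentence (σ : Vocabulary.{u}) (τ : Vocabulary.{v}) : Type (max u v) :=
  Formula σ τ 0

/-- `A`-valued `τ`-structures with domain `M`: a map `R^𝔐 : M^{τ(R)} → A` for each `R ∈ τ`. -/
abbrev Model (τ : Vocabulary.{u}) (A : Type v) (M : Type w) : Type (max u v w) :=
  (R : τ.Symb) → (Fin (τ.arity R) → M) → A

/-- The truth value `‖φ‖^𝔐(i₀, …, i_{k-1})` in a structure with finite nonempty domain.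
Connectives are interpreted by the algebra, `∀` and `∃` by infima and suprema over the domain. -/
def Formula.value {σ : Vocabulary.{u}} {τ : Vocabulary.{v}} {A : Type w} [Lattice A]
    (op : Operations σ A) {M : Type x} [Fintype M] [Nonempty M] (𝔐 : Model τ A M) :
    {k : ℕ} → Formula σ τ k → (Fin k → M) → A
  | _, .rel R xs, i => 𝔐 R (fun j => i (xs j))
  | _, .and φ ψ, i => φ.value op 𝔐 i ⊓ ψ.value op 𝔐 i
  | _, .or φ ψ, i => φ.value op 𝔐 i ⊔ ψ.value op 𝔐 i
  | _, .conn c φs, i => op c (fun j => (φs j).value op 𝔐 i)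
  | _, .all φ, i => Finset.univ.inf' Finset.univ_nonempty (fun m : M => φ.value op 𝔐 (Fin.snoc i m))
  | _, .ex φ, i => Finset.univ.sup' Finset.univ_nonempty (fun m : M => φ.value op 𝔐 (Fin.snoc i m))

/-- The probability of a structure when the values of the atomic statements
`R(i₁, …, i_{τ(R)})` are chosen independently with distributions `p R`. -/
noncomputable def modelProb {τ : Vocabulary.{u}} [Fintype τ.Symb] {A : Type v} {M : Type w}
    [Fintype M] (p : τ.Symb → A → ℝ) (𝔐 : Model τ A M) : ℝ :=
  open Classical in ∏ R : τ.Symb, ∏ i : Fin (τ.arity R) → M, p R (𝔐 R i)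

/-- The probability `μ(φ(i₀, …, i_{k-1}) = a)` that a random `A`-valued structure with domain
`M` gives the value `a` to `φ(i₀, …, i_{k-1})`. -/
noncomputable def valueProb {σ : Vocabulary.{u}} {τ : Vocabulary.{v}} [Fintype τ.Symb]
    {A : Type w} [Lattice A] [Fintype A] (op : Operations σ A) (p : τ.Symb → A → ℝ)
    {M : Type x} [Fintype M] [Nonempty M] {k : ℕ} (φ : Formula σ τ k) (i : Fin k → M) (a : A) : ℝ :=
  open Classical in ∑ 𝔐 : Model τ A M with φ.value op 𝔐 i = a, modelProb p 𝔐

/-- The sequence `μ_n(φ = a)` for a sentence `φ`, with domain `[n]` of size `n ≥ 1`; the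
argument `n` of this function stands for the domain of size `n + 1`. -/
noncomputable def sentenceProb {σ : Vocabulary.{u}} {τ : Vocabulary.{v}} [Fintype τ.Symb]
    {A : Type w} [Lattice A] [Fintype A] (op : Operations σ A) (p : τ.Symb → A → ℝ)
    (φ : Sentence σ τ) (a : A) (n : ℕ) : ℝ :=
  valueProb op p (M := Fin (n + 1)) φ Fin.elim0 a

end ManyValued

/-!
A random structure on a large domain is generic with probability tending to `1`: over every small
tuple, each atomic type is realised by some outside element. Indeed the atomic types of the
outside elements over a fixed tuple are independent with one and the same law, which charges every
type, so a given type is missed with probability exponentially small in the size of the domain,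
while there are only polynomially many tuples. Between generic structures the back-and-forth
argument applies, so the value of a formula depends only on the atomic type of the tuple
substituted into it. All arities being positive, there is only one atomic type of the empty tuple,
and hence a sentence takes the same value in all sufficiently generic structures.
-/

namespace ManyValued

open MeasureTheory Measure

section Probability

theorem exists_isProbabilityMeasure_measureReal_singleton_eq {α : Type*} [Fintype α]
    [MeasurableSpace α] [MeasurableSingletonClass α] {p : α → ℝ} (hp_nonneg : ∀ a, 0 ≤ p a)
    (hp_sum : ∑ a, p a = 1) :
    ∃ ν : Measure α, IsProbabilityMeasure ν ∧ ∀ a, ν.real {a} = p a := by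
  have hsum : ∑ a, ENNReal.ofReal (p a) = 1 := by
    rw [← ENNReal.ofReal_sum_of_nonneg fun a _ => hp_nonneg a, hp_sum, ENNReal.ofReal_one]
  refine ⟨(PMF.ofFintype _ hsum).toMeasure, inferInstance, fun a => ?_⟩
  rw [measureReal_def, PMF.toMeasure_apply_singleton _ _ (measurableSet_singleton a),
    PMF.ofFintype_apply, ENNReal.toReal_ofReal (hp_nonneg a)]

theorem infinitePi_map_curry_comp_of_injective {ι S D α : Type*} [MeasurableSpace α]
    (μ : ι → Measure α) [∀ i, IsProbabilityMeasure (μ i)] {e : S × D → ι}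
    (he : Function.Injective e) :
    (infinitePi μ).map (fun x s d => x (e (s, d))) =
      infinitePi fun s => infinitePi fun d => μ (e (s, d)) := by
  rw [← infinitePi_map_curry fun s d => μ (e (s, d)), ← map_infinitePi_infinitePi_of_inj he,
    map_map (by fun_prop) (by fun_prop)]
  rfl

theorem infinitePi_measureReal_singleton {ι : Type*} [Fintype ι] {α : ι → Type*}
    [∀ i, MeasurableSpace (α i)] [∀ i, MeasurableSingletonClass (α i)] (μ : ∀ i, Measure (α i))
    [∀ i, IsProbabilityMeasure (μ i)] (x : ∀ i, α i) :
    (infinitePi μ).real {x} = ∏ i, (μ i).real {x i} := by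
  simp only [measureReal_def, infinitePi_singleton_of_fintype, ENNReal.toReal_prod]

theorem measurableSet_forall_ne {ι α : Type*} [Countable ι] [MeasurableSpace α]
    [MeasurableSingletonClass α] (a : α) : MeasurableSet {x : ι → α | ∀ i, x i ≠ a} := by
  simp only [Set.ofPred_forall]
  exact .iInter fun i => (measurableSet_singleton a).compl.preimage (measurable_pi_apply i)

theorem infinitePi_measureReal_forall_ne {ι α : Type*} [Fintype ι] [MeasurableSpace α]
    [MeasurableSingletonClass α] (μ : Measure α) [IsProbabilityMeasure μ] (a : α) :
    (infinitePi fun _ : ι => μ).real {x | ∀ i, x i ≠ a} = (1 - μ.real {a}) ^ Fintype.card ι := by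
  have hpi : {x : ι → α | ∀ i, x i ≠ a} = Set.univ.pi fun _ => {a}ᶜ := by
    ext x
    simp only [Set.mem_ofPred_eq, Set.mem_univ_pi, Set.mem_compl_singleton_iff]
  rw [hpi, infinitePi_eq_pi, measureReal_def, pi_pi, ENNReal.toReal_prod, Finset.prod_const,
    ← measureReal_def, probReal_compl_eq_one_sub (measurableSet_singleton a), Finset.card_univ]

variable {ι : Type*} {l : Filter ι} {Ω : ι → Type*} [∀ n, MeasurableSpace (Ω n)]
  {μ : ∀ n, Measure (Ω n)} {E G : ∀ n, Set (Ω n)}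

theorem exists_nonempty_of_tendsto_measureReal_compl [l.NeBot] [∀ n, IsProbabilityMeasure (μ n)]
    (hG : Tendsto (fun n => (μ n).real (G n)ᶜ) l (𝓝 0)) : ∃ n, (G n).Nonempty := by
  by_contra! h
  simp [h] at hG

theorem tendsto_measureReal_of_disjoint [∀ n, IsFiniteMeasure (μ n)]
    (hG : Tendsto (fun n => (μ n).real (G n)ᶜ) l (𝓝 0)) (hE : ∀ n, Disjoint (E n) (G n)) :
    Tendsto (fun n => (μ n).real (E n)) l (𝓝 0) :=
  squeeze_zero (fun _ => measureReal_nonneg)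
    (fun n => measureReal_mono (hE n).subset_compl_right) hG

theorem tendsto_measureReal_of_subset [∀ n, IsProbabilityMeasure (μ n)]
    (hE : ∀ n, MeasurableSet (E n)) (hG : Tendsto (fun n => (μ n).real (G n)ᶜ) l (𝓝 0))
    (hGE : ∀ n, G n ⊆ E n) : Tendsto (fun n => (μ n).real (E n)) l (𝓝 1) := by
  have hcompl := tendsto_measureReal_of_disjoint hG
    fun n => Set.disjoint_compl_left_iff_subset.2 (hGE n)
  simpa only [probReal_compl_eq_one_sub (hE _), sub_sub_cancel, sub_zero] using
    hcompl.const_sub 1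

theorem tendsto_descFactorial_mul_pow_sub (k : ℕ) {r : ℝ} (hr : |r| < 1) :
    Tendsto (fun n : ℕ => n.descFactorial k * r ^ (n - k)) atTop (𝓝 0) := by
  rw [← tendsto_add_atTop_iff_nat k]
  simp only [Nat.add_sub_cancel]
  exact (summable_descFactorial_mul_geometric_of_norm_lt_one (R := ℝ) k hr).tendsto_atTop_zero

end Probability

section RandomModel

variable {τ : Vocabulary} {A : Type*} [MeasurableSpace A]

/-- The law of a random `A`-valued structure with domain `M` whose atomic statements
`R(i₁, …, i_{τ(R)})` take independent values with distribution `ν R`. -/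
noncomputable def modelMeasure (ν : τ.Symb → Measure A) (M : Type*) : Measure (Model τ A M) :=
  infinitePi fun R => infinitePi fun _ : Fin (τ.arity R) → M => ν R

variable (ν : τ.Symb → Measure A) [∀ R, IsProbabilityMeasure (ν R)] {M : Type*}

instance isProbabilityMeasure_modelMeasure : IsProbabilityMeasure (modelMeasure ν M) := by
  unfold modelMeasure
  infer_instance

theorem modelMeasure_map_atoms :
    (modelMeasure ν M).map (fun 𝔐 (t : Σ R, Fin (τ.arity R) → M) => 𝔐 t.1 t.2) =
      infinitePi fun t => ν t.1 :=
  infinitePi_map_piCurry_symm fun R _ => ν R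

variable [Fintype τ.Symb] [Fintype M]

theorem modelProb_measureReal_singleton [MeasurableSingletonClass A] (𝔐 : Model τ A M) :
    modelProb (fun R a => (ν R).real {a}) 𝔐 = (modelMeasure ν M).real {𝔐} := by
  simp only [modelProb, modelMeasure, measureReal_def, infinitePi_singleton_of_fintype,
    ENNReal.toReal_prod]

theorem valueProb_measureReal_singleton [Lattice A] [Fintype A] [MeasurableSingletonClass A]
    [Nonempty M] {σ : Vocabulary} (op : Operations σ A) {k : ℕ} (φ : Formula σ τ k)
    (i : Fin k → M) (a : A) :
    valueProb op (fun R a => (ν R).real {a}) φ i a =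
      (modelMeasure ν M).real {𝔐 | φ.value op 𝔐 i = a} := by
  simp only [valueProb, modelProb_measureReal_singleton, sum_measureReal_singleton,
    Finset.coe_filter_univ]

end RandomModel

section Extensions

/-- The atomic formulas in the variables `x₀, …, x_k` in which the last variable `x_k` occurs. -/
abbrev LastAtom (τ : Vocabulary) (k : ℕ) :=
  Σ R : τ.Symb, {xs : Fin (τ.arity R) → Fin (k + 1) // ∃ s, xs s = Fin.last k}

variable {τ : Vocabulary} {A M : Type*} {k : ℕ}

/-- The atomic type of an element `m` over a tuple `j`: the truth values of the atomic statements
about `m` and the entries of `j` in which `m` occurs. -/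
def typeOver (𝔐 : Model τ A M) (j : Fin k → M) (m : M) : LastAtom τ k → A :=
  fun d => 𝔐 d.1 ((Fin.snoc j m : Fin (k + 1) → M) ∘ d.2.1)

/-- The extension property: every conceivable atomic type over a tuple of `k` distinct elements is
realised by an element outside the tuple. -/
def HasExtensions (k : ℕ) (𝔐 : Model τ A M) : Prop :=
  ∀ (j : Fin k ↪ M) (f : LastAtom τ k → A), ∃ m ∉ Set.range j, typeOver 𝔐 j m = f

theorem injective_atomOver (j : Fin k ↪ M) :
    Function.Injective fun q : ↥(Set.range j)ᶜ × LastAtom τ k =>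
      (⟨q.2.1, (Fin.snoc j q.1.1 : Fin (k + 1) → M) ∘ q.2.2.1⟩ :
        Σ R : τ.Symb, Fin (τ.arity R) → M) := by
  rintro ⟨⟨m, hm⟩, R, xs, s, hs⟩ ⟨⟨m', hm'⟩, R', xs', hs'⟩ h
  obtain ⟨rfl, h⟩ := Sigma.mk.inj_iff.1 h
  have hvalues := congrFun (eq_of_heq h)
  dsimp only [Function.comp_apply] at hvalues
  obtain rfl : m = m' := by
    have hms := hvalues s
    rw [hs, Fin.snoc_last] at hms
    cases hx : xs' s using Fin.lastCases with
    | last => simpa only [hx, Fin.snoc_last] using hms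
    | cast t =>
      rw [hx, Fin.snoc_castSucc] at hms
      exact absurd ⟨t, hms.symm⟩ hm
  obtain rfl : xs = xs' :=
    funext fun t => Fin.snoc_injective_of_injective j.injective hm (hvalues t)
  rfl

variable [MeasurableSpace A] (ν : τ.Symb → Measure A) [∀ R, IsProbabilityMeasure (ν R)]

/- The atomic types of the elements outside a tuple are independent and identically distributed,
because distinct elements contribute distinct atomic statements. -/
theorem modelMeasure_map_typeOver (j : Fin k ↪ M) :
    (modelMeasure ν M).map (fun 𝔐 (m : ↥(Set.range j)ᶜ) => typeOver 𝔐 j m) =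
      infinitePi fun _ => infinitePi fun d : LastAtom τ k => ν d.1 := by
  rw [← infinitePi_map_curry_comp_of_injective (fun t => ν t.1) (injective_atomOver j),
    ← modelMeasure_map_atoms, map_map (by fun_prop) (by fun_prop)]
  rfl

variable [Fintype τ.Symb] [MeasurableSingletonClass A]

theorem measureReal_forall_typeOver_ne [Fintype M] (j : Fin k ↪ M) (f : LastAtom τ k → A) :
    (modelMeasure ν M).real {𝔐 | ∀ m ∉ Set.range j, typeOver 𝔐 j m ≠ f} =
      (1 - ∏ d, (ν d.1).real {f d}) ^ (Fintype.card M - k) := by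
  classical
  have hpreimage : {𝔐 : Model τ A M | ∀ m ∉ Set.range j, typeOver 𝔐 j m ≠ f} =
      (fun 𝔐 (m : ↥(Set.range j)ᶜ) => typeOver 𝔐 j m) ⁻¹' {x | ∀ m, x m ≠ f} :=
    Set.ext fun 𝔐 => (Subtype.forall (p := fun m => m ∈ (Set.range j)ᶜ)
      (q := fun m => typeOver 𝔐 j m ≠ f)).symm
  have hmeasurable : Measurable
      fun (𝔐 : Model τ A M) (m : ↥(Set.range j)ᶜ) => typeOver 𝔐 j m := by
    unfold typeOver
    fun_prop
  have hcard : Fintype.card ↥(Set.range j)ᶜ = Fintype.card M - k := by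
    rw [Fintype.card_compl_set, Set.card_range_of_injective j.injective, Fintype.card_fin]
  rw [hpreimage, ← map_measureReal_apply hmeasurable (measurableSet_forall_ne f),
    modelMeasure_map_typeOver, infinitePi_measureReal_forall_ne,
    infinitePi_measureReal_singleton, hcard]

variable [Fintype A]

open Classical in
theorem measureReal_not_hasExtensions_le [Fintype M] (k : ℕ) :
    (modelMeasure ν M).real {𝔐 | ¬ HasExtensions k 𝔐} ≤
      ∑ f : LastAtom τ k → A, (Fintype.card M).descFactorial k *
        (1 - ∏ d, (ν d.1).real {f d}) ^ (Fintype.card M - k) := by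
  have hunion : {𝔐 : Model τ A M | ¬ HasExtensions k 𝔐} =
      ⋃ q : (LastAtom τ k → A) × (Fin k ↪ M),
        {𝔐 | ∀ m ∉ Set.range q.2, typeOver 𝔐 q.2 m ≠ q.1} := by
    ext 𝔐
    simp only [HasExtensions, Set.mem_ofPred_eq, Set.mem_iUnion, Prod.exists]
    push Not
    exact exists_comm
  rw [hunion]
  refine (measureReal_iUnion_fintype_le _).trans_eq ?_
  simp only [measureReal_forall_typeOver_ne, Fintype.sum_prod_type, Finset.sum_const,
    Finset.card_univ, Fintype.card_embedding_eq, Fintype.card_fin, nsmul_eq_mul]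

end Extensions

section Generic

variable {τ : Vocabulary} {A M : Type*}

/-- A structure is `K`-generic if it has the extension property over all tuples of fewer than `K`
distinct elements. -/
def IsGeneric (K : ℕ) (𝔐 : Model τ A M) : Prop :=
  ∀ k < K, HasExtensions k 𝔐

theorem IsGeneric.mono {K K' : ℕ} (hK : K ≤ K') {𝔐 : Model τ A M} (h : IsGeneric K' 𝔐) :
    IsGeneric K 𝔐 :=
  fun k hk => h k (hk.trans_le hK)

variable [Finite τ.Symb] [Finite A] [MeasurableSpace A] [MeasurableSingletonClass A]
  {ν : τ.Symb → Measure A} [∀ R, IsProbabilityMeasure (ν R)]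

theorem tendsto_measureReal_not_hasExtensions (hν : ∀ R a, 0 < (ν R).real {a}) (k : ℕ) :
    Tendsto (fun n => (modelMeasure ν (Fin n)).real {𝔐 | ¬ HasExtensions k 𝔐}) atTop (𝓝 0) := by
  classical
  cases nonempty_fintype τ.Symb
  cases nonempty_fintype A
  have hratio : ∀ f : LastAtom τ k → A, |1 - ∏ d, (ν d.1).real {f d}| < 1 := fun f => by
    have hpos : 0 < ∏ d, (ν d.1).real {f d} := Finset.prod_pos fun d _ => hν _ _
    have hle : ∏ d, (ν d.1).real {f d} ≤ 1 :=
      Finset.prod_le_one (fun d _ => measureReal_nonneg) fun d _ => measureReal_le_one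
    rw [abs_lt]
    constructor <;> linarith
  have hbound : Tendsto (fun n : ℕ => ∑ f : LastAtom τ k → A, n.descFactorial k *
      (1 - ∏ d, (ν d.1).real {f d}) ^ (n - k)) atTop (𝓝 0) := by
    simpa only [Finset.sum_const_zero] using tendsto_finsetSum Finset.univ
      fun f _ => tendsto_descFactorial_mul_pow_sub k (hratio f)
  refine squeeze_zero (fun _ => measureReal_nonneg) (fun n => ?_) hbound
  simpa only [Fintype.card_fin] using measureReal_not_hasExtensions_le ν (M := Fin n) k

theorem tendsto_measureReal_compl_isGeneric (hν : ∀ R a, 0 < (ν R).real {a}) (K : ℕ) :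
    Tendsto (fun n => (modelMeasure ν (Fin n)).real {𝔐 | IsGeneric K 𝔐}ᶜ) atTop (𝓝 0) := by
  have hunion : ∀ n, {𝔐 : Model τ A (Fin n) | IsGeneric K 𝔐}ᶜ =
      ⋃ k ∈ Finset.range K, {𝔐 | ¬ HasExtensions k 𝔐} := fun n => by
    ext 𝔐
    simp [IsGeneric]
  have hsum : Tendsto (fun n => ∑ k ∈ Finset.range K,
      (modelMeasure ν (Fin n)).real {𝔐 | ¬ HasExtensions k 𝔐}) atTop (𝓝 0) := by
    simpa only [Finset.sum_const_zero] using tendsto_finsetSum (Finset.range K)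
      fun k _ => tendsto_measureReal_not_hasExtensions hν k
  simp only [hunion]
  exact squeeze_zero (fun _ => measureReal_nonneg)
    (fun _ => measureReal_biUnion_finset_le _ _) hsum

end Generic

section BackAndForth

variable {τ : Vocabulary} {A M N : Type*} {𝔐 : Model τ A M} {𝔑 : Model τ A N} {k : ℕ}
  {i : Fin k → M} {j : Fin k → N}

/-- The tuples `i` and `j` have the same atomic type, equality included: `i s ↦ j s` is a
well-defined partial isomorphism. -/
structure SameType (𝔐 : Model τ A M) (𝔑 : Model τ A N) (i : Fin k → M) (j : Fin k → N) :
    Prop where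
  eq_iff : ∀ s t, i s = i t ↔ j s = j t
  rel_eq : ∀ (R : τ.Symb) (xs : Fin (τ.arity R) → Fin k), 𝔐 R (i ∘ xs) = 𝔑 R (j ∘ xs)

namespace SameType

theorem of_fin_zero (hτ : ∀ R : τ.Symb, 0 < τ.arity R) (i : Fin 0 → M) (j : Fin 0 → N) :
    SameType 𝔐 𝔑 i j where
  eq_iff s := s.elim0
  rel_eq R xs := (xs ⟨0, hτ R⟩).elim0

theorem symm (h : SameType 𝔐 𝔑 i j) : SameType 𝔑 𝔐 j i where
  eq_iff s t := (h.eq_iff s t).symm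
  rel_eq R xs := (h.rel_eq R xs).symm

theorem comp (h : SameType 𝔐 𝔑 i j) {l : ℕ} (g : Fin l → Fin k) :
    SameType 𝔐 𝔑 (i ∘ g) (j ∘ g) where
  eq_iff s t := h.eq_iff (g s) (g t)
  rel_eq R xs := h.rel_eq R (g ∘ xs)

theorem snoc (h : SameType 𝔐 𝔑 i j) {m : M} {n : N} (hm : m ∉ Set.range i)
    (hn : n ∉ Set.range j) (hmn : typeOver 𝔐 i m = typeOver 𝔑 j n) :
    SameType 𝔐 𝔑 (Fin.snoc i m : Fin (k + 1) → M) (Fin.snoc j n : Fin (k + 1) → N) where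
  eq_iff s t := by
    simp only [Set.mem_range, not_exists] at hm hn
    cases s using Fin.lastCases <;> cases t using Fin.lastCases <;>
      simp [h.eq_iff, hm, hn, Ne.symm (hm _), Ne.symm (hn _)]
  rel_eq R xs := by
    by_cases hlast : ∃ s, xs s = Fin.last k
    · exact congrFun hmn ⟨R, xs, hlast⟩
    · push Not at hlast
      choose ys hys using fun s => Fin.exists_castSucc_eq.2 (hlast s)
      obtain rfl : Fin.castSucc ∘ ys = xs := funext hys
      simpa only [← Function.comp_assoc, Fin.snoc_comp_castSucc] using h.rel_eq R ys

end SameType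

theorem exists_injective_comp_eq (i : Fin k → M) :
    ∃ l ≤ k, ∃ (e : Fin l → Fin k) (g : Fin k → Fin l),
      Function.Injective (i ∘ e) ∧ i ∘ e ∘ g = i := by
  classical
  let enum : Set.range i ≃ Fin (Fintype.card (Set.range i)) := Fintype.equivFin _
  refine ⟨_, (Fintype.card_range_le i).trans_eq (Fintype.card_fin k),
    Set.rangeSplitting i ∘ enum.symm, enum ∘ Set.rangeFactorization i, ?_, ?_⟩
  · rw [← Function.comp_assoc]
    have hval : i ∘ Set.rangeSplitting i = Subtype.val := funext (Set.apply_rangeSplitting i)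
    rw [hval]
    exact Subtype.val_injective.comp enum.symm.injective
  · funext s
    simp only [Function.comp_apply, Equiv.symm_apply_apply, Set.apply_rangeSplitting,
      Set.rangeFactorization_coe]

theorem SameType.exists_snoc (h : SameType 𝔐 𝔑 i j) (hN : IsGeneric (k + 1) 𝔑) (m : M) :
    ∃ n, SameType 𝔐 𝔑 (Fin.snoc i m : Fin (k + 1) → M) (Fin.snoc j n : Fin (k + 1) → N) := by
  by_cases hm : m ∈ Set.range i
  · obtain ⟨t, rfl⟩ := hm
    have hcomp := h.comp (Fin.snoc id t : Fin (k + 1) → Fin k)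
    rw [Fin.comp_snoc, Fin.comp_snoc] at hcomp
    exact ⟨j t, hcomp⟩
  obtain ⟨l, hl, e, g, hinj, hi⟩ := exists_injective_comp_eq i
  have hj : j ∘ e ∘ g = j := funext fun s => (h.eq_iff _ _).1 (congrFun hi s)
  have hje : Function.Injective (j ∘ e) := fun s t hst => hinj ((h.eq_iff _ _).2 hst)
  obtain ⟨n, hn, htype⟩ := hN l (Nat.lt_succ_of_le hl) ⟨_, hje⟩ (typeOver 𝔐 (i ∘ e) m)
  have hme : m ∉ Set.range (i ∘ e) := fun hmem => hm (Set.range_comp_subset_range e i hmem)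
  have hsnoc := ((h.comp e).snoc hme hn htype.symm).comp
    (Fin.snoc (Fin.castSucc ∘ g) (Fin.last l) : Fin (k + 1) → Fin (l + 1))
  simp only [Fin.comp_snoc, ← Function.comp_assoc, Fin.snoc_comp_castSucc, Fin.snoc_last]
    at hsnoc
  simp only [← Function.comp_assoc] at hi hj
  rw [hi, hj] at hsnoc
  exact ⟨n, hsnoc⟩

end BackAndForth

section ValueOnGeneric

theorem univ_inf'_eq_of_range_eq {α β γ : Type*} [SemilatticeInf γ] [Fintype α] [Nonempty α]
    [Fintype β] [Nonempty β] {f : α → γ} {g : β → γ} (h : Set.range f = Set.range g) :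
    Finset.univ.inf' Finset.univ_nonempty f = Finset.univ.inf' Finset.univ_nonempty g :=
  eq_of_forall_le_iff fun c => by
    simp only [Finset.le_inf'_iff, Finset.mem_univ, true_imp_iff]
    rw [← Set.forall_mem_range (p := (c ≤ ·)), h, Set.forall_mem_range]

theorem univ_sup'_eq_of_range_eq {α β γ : Type*} [SemilatticeSup γ] [Fintype α] [Nonempty α]
    [Fintype β] [Nonempty β] {f : α → γ} {g : β → γ} (h : Set.range f = Set.range g) :
    Finset.univ.sup' Finset.univ_nonempty f = Finset.univ.sup' Finset.univ_nonempty g :=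
  univ_inf'_eq_of_range_eq (γ := γᵒᵈ) h

variable {σ τ : Vocabulary} {A M N : Type*}

/-- The nesting depth of quantifiers in a formula. -/
def Formula.quantifierRank {k : ℕ} : Formula σ τ k → ℕ
  | .rel _ _ => 0
  | .and φ ψ => max φ.quantifierRank ψ.quantifierRank
  | .or φ ψ => max φ.quantifierRank ψ.quantifierRank
  | .conn _ φs => Finset.univ.sup fun s => (φs s).quantifierRank
  | .all φ => φ.quantifierRank + 1
  | .ex φ => φ.quantifierRank + 1

variable [Lattice A] (op : Operations σ A) [Fintype M] [Nonempty M] [Fintype N] [Nonempty N]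
  {𝔐 : Model τ A M} {𝔑 : Model τ A N} {K : ℕ}

theorem range_value_snoc_eq (hM : IsGeneric K 𝔐) (hN : IsGeneric K 𝔑) {k : ℕ} (hk : k < K)
    {φ : Formula σ τ (k + 1)}
    (hφ : ∀ {i : Fin (k + 1) → M} {j : Fin (k + 1) → N}, SameType 𝔐 𝔑 i j →
      φ.value op 𝔐 i = φ.value op 𝔑 j)
    {i : Fin k → M} {j : Fin k → N} (h : SameType 𝔐 𝔑 i j) :
    Set.range (fun m => φ.value op 𝔐 (Fin.snoc i m)) =
      Set.range fun n => φ.value op 𝔑 (Fin.snoc j n) := by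
  apply Set.Subset.antisymm <;> rintro _ ⟨x, rfl⟩
  · obtain ⟨n, hn⟩ := h.exists_snoc (hN.mono hk) x
    exact ⟨n, (hφ hn).symm⟩
  · obtain ⟨m, hm⟩ := h.symm.exists_snoc (hM.mono hk) x
    exact ⟨m, hφ hm.symm⟩

theorem SameType.value_eq (hM : IsGeneric K 𝔐) (hN : IsGeneric K 𝔑) {k : ℕ}
    {φ : Formula σ τ k} (hφ : k + φ.quantifierRank ≤ K) {i : Fin k → M} {j : Fin k → N}
    (h : SameType 𝔐 𝔑 i j) : φ.value op 𝔐 i = φ.value op 𝔑 j := by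
  induction φ with
  | rel R xs => exact h.rel_eq R xs
  | and φ ψ ihφ ihψ | or φ ψ ihφ ihψ =>
    rw [Formula.quantifierRank] at hφ
    rw [Formula.value, Formula.value, ihφ (by lia) h, ihψ (by lia) h]
  | conn c φs ih =>
    have hle : ∀ s, (φs s).quantifierRank ≤ (Formula.conn c φs).quantifierRank := fun s =>
      Finset.le_sup (f := fun s => (φs s).quantifierRank) (Finset.mem_univ s)
    exact congrArg (op c) (funext fun s => ih s (by have := hle s; lia) h)
  | all φ ih =>
    rw [Formula.quantifierRank] at hφ
    exact univ_inf'_eq_of_range_eq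
      (range_value_snoc_eq op hM hN (by lia) (fun h' => ih (by lia) h') h)
  | ex φ ih =>
    rw [Formula.quantifierRank] at hφ
    exact univ_sup'_eq_of_range_eq
      (range_value_snoc_eq op hM hN (by lia) (fun h' => ih (by lia) h') h)

end ValueOnGeneric

section Limits

variable {σ τ : Vocabulary} [Fintype τ.Symb] {A : Type*} [Lattice A] [Fintype A]
  [MeasurableSpace A] [MeasurableSingletonClass A] {ν : τ.Symb → Measure A}
  [∀ R, IsProbabilityMeasure (ν R)]

theorem exists_tendsto_sentenceProb_one_and_zero (hτ : ∀ R : τ.Symb, 0 < τ.arity R)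
    (op : Operations σ A) (hν : ∀ R a, 0 < (ν R).real {a}) (φ : Sentence σ τ) :
    ∃ b, Tendsto (sentenceProb op (fun R a => (ν R).real {a}) φ b) atTop (𝓝 1) ∧
      ∀ a ≠ b, Tendsto (sentenceProb op (fun R a => (ν R).real {a}) φ a) atTop (𝓝 0) := by
  have hgeneric : Tendsto (fun n => (modelMeasure ν (Fin (n + 1))).real
      {𝔐 | IsGeneric φ.quantifierRank 𝔐}ᶜ) atTop (𝓝 0) :=
    (tendsto_measureReal_compl_isGeneric hν φ.quantifierRank).comp (tendsto_add_atTop_nat 1)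
  obtain ⟨n₀, 𝔐₀, h𝔐₀⟩ := exists_nonempty_of_tendsto_measureReal_compl hgeneric
  have hvalue : ∀ (n : ℕ) (𝔐 : Model τ A (Fin (n + 1))), IsGeneric φ.quantifierRank 𝔐 →
      φ.value op 𝔐 Fin.elim0 = φ.value op 𝔐₀ Fin.elim0 := fun n 𝔐 h𝔐 =>
    (SameType.of_fin_zero hτ _ _).value_eq op h𝔐 h𝔐₀ (Nat.zero_add _).le
  have hprob : ∀ a, sentenceProb op (fun R a => (ν R).real {a}) φ a = fun n =>
      (modelMeasure ν (Fin (n + 1))).real {𝔐 | φ.value op 𝔐 Fin.elim0 = a} := fun a =>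
    funext fun n => valueProb_measureReal_singleton ν op φ _ a
  refine ⟨φ.value op 𝔐₀ Fin.elim0, ?_, fun a ha => ?_⟩
  · rw [hprob]
    exact tendsto_measureReal_of_subset (fun n => Set.Finite.measurableSet (Set.toFinite _))
      hgeneric hvalue
  · rw [hprob]
    exact tendsto_measureReal_of_disjoint hgeneric fun n => Set.disjoint_left.2
      fun 𝔐 h𝔐a h𝔐 => ha (h𝔐a.symm.trans (hvalue n 𝔐 h𝔐))

end Limits

end ManyValued

theorem mainTheorem1
    {σ : ManyValued.Vocabulary} {τ : ManyValued.Vocabulary} [Fintype τ.Symb]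
    (hτ : ∀ R : τ.Symb, 0 < τ.arity R)
    {A : Type*} [Lattice A] [Fintype A] (op : ManyValued.Operations σ A)
    (p : τ.Symb → A → ℝ) (hp_pos : ∀ R a, 0 < p R a) (hp_sum : ∀ R, ∑ a, p R a = 1)
    (φ : ManyValued.Sentence σ τ) :
    (∀ a : A, Tendsto (ManyValued.sentenceProb op p φ a) atTop (𝓝 1) ∨
        Tendsto (ManyValued.sentenceProb op p φ a) atTop (𝓝 0)) ∧
      ∃! a : A, Tendsto (ManyValued.sentenceProb op p φ a) atTop (𝓝 1) := by
  let _ : MeasurableSpace A := ⊤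
  choose ν hν hνp using fun R =>
    ManyValued.exists_isProbabilityMeasure_measureReal_singleton_eq
      (fun a => (hp_pos R a).le) (hp_sum R)
  obtain rfl : (fun R a => (ν R).real {a}) = p := funext₂ hνp
  obtain ⟨b, hone, hzero⟩ := ManyValued.exists_tendsto_sentenceProb_one_and_zero hτ op hp_pos φ
  refine ⟨fun a => ?_, b, hone, fun a ha => ?_⟩
  · rcases eq_or_ne a b with rfl | hab
    · exact Or.inl hone
    · exact Or.inr (hzero a hab)
  · by_contra hab
    exact one_ne_zero (tendsto_nhds_unique ha (hzero a hab))
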